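/- Let $\varphi$ be the morphism on finite words over $\{0,1\}$ given by $\varphi(0)=01$, $\varphi(1)=10$, and let $\mathbf{t}=01101001\cdots$ be the Thue–Morse word, i.e. the fixed point of $\varphi$ starting with $0$. For finite words $u,x$ over $\{0,1\}$, let $\binom{u}{x}$ be the number of occurrences of $x$ as a (not necessarily contiguous) subsequence of $u$. For $k\ge 1$, write $u\sim_k v$ if $\binom{u}{x}=\binom{v}{x}$ for all words $x$ over $\{0,1\}$ of length at most $k$. Let $\mathrm{Fac}_n(\mathbf{t})$ be the set of factors (blocks of consecutive letters) of length $n$ occurring in $\mathbf{t}$, let $p_{\mathbf{t}}(n)=\#\mathrm{Fac}_n(\mathbf{t})$ be the factor complexity, and let $b_{\mathbf{t},k}(n)=\#\left(\mathrm{Fac}_n(\mathbf{t})/\!\sim_k\right)$ be the $k$-binomial complexity of $\mathbf{t}$. Let $k$ be a positive integer. For all integers $0\le n\le 2^k-1$, we have $$b_{\mathbf{t},k}(n)=p_{\mathbf{t}}(n).$$ For all integers $n\ge 2^k$, we have $$b_{\mathbf{t},k}(n)=\begin{cases}3\cdot 2^k-3, & \text{if } n\equiv 0 \pmod{2^k};\\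 3\cdot 2^k-4, & \text{otherwise.}\end{cases}$$ -/

import Mathlib

namespace ThueMorse

/-- The two-letter alphabet `{0, 1}`. -/
abbrev Letter : Type := Fin 2

/-- Finite words over `{0, 1}`. -/
abbrev Word : Type := List Letter

/-- Infinite words over `{0, 1}`, indexed from `0`. -/
abbrev InfWord : Type := ℕ → Letter

/-- The factor of length `n` of `x` that starts at position `i`. -/
def factorAt (x : InfWord) (i n : ℕ) : Word :=
  (List.range n).map fun j => x (i + j)

/-- The set of factors (blocks of consecutive letters) of length `n` occurring in `x`. -/
def Fac (x : InfWord) (n : ℕ) : Set Word :=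
  {w | ∃ i : ℕ, w = factorAt x i n}

/-- The factor complexity of `x`: the number of its factors of length `n`. -/
noncomputable def factorComplexity (x : InfWord) (n : ℕ) : ℕ :=
  Nat.card (Fac x n)

/-- The binomial coefficient of two words: the number of occurrences of `v` as a subsequence
of `u`. The list `u.sublists'` has one entry for each set of positions of `u`, so `v` is counted
with multiplicity. -/
def binom (u v : Word) : ℕ :=
  u.sublists'.count v

/-- `k`-binomial equivalence, as a relation on words. -/
def binomSetoid (k : ℕ) : Setoid Word where
  r u v := ∀ x : Word, x.length ≤ k → binom u x = binom v x
  iseqv :=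
    { refl := fun _ _ _ => rfl
      symm := fun h x hx => (h x hx).symm
      trans := fun h h' x hx => (h x hx).trans (h' x hx) }

/-- The `k`-binomial complexity of `x`: the number of classes, for the restriction of
`k`-binomial equivalence, of factors of length `n`. -/
noncomputable def binomComplexity (x : InfWord) (k n : ℕ) : ℕ :=
  Nat.card (Quotient ((binomSetoid k).comap (Subtype.val : Fac x n → Word)))

/-- Images of letters under the Thue–Morse morphism: `0 ↦ 01` and `1 ↦ 10`. -/
def phiLetter (a : Letter) : Word :=
  if a = 0 then [0, 1] else [1, 0]

/-- The Thue–Morse morphism on finite words. -/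
def phi (w : Word) : Word :=
  w.flatMap phiLetter

theorem length_phi (w : Word) : (phi w).length = 2 * w.length := by
  induction w with
  | nil => rfl
  | cons a w ih =>
    have h : (phiLetter a).length = 2 := by fin_cases a <;> rfl
    simp only [phi, List.flatMap_cons, List.length_append, List.length_cons] at ih ⊢
    omega

theorem length_phi_iterate (n : ℕ) : (phi^[n] [0]).length = 2 ^ n := by
  induction n with
  | zero => rfl
  | succ n ih => rw [Function.iterate_succ_apply', length_phi, ih, pow_succ']

/-- The Thue–Morse word, the limit of the words `φⁿ(0)`: its letter at position `n` is the one
of `φⁿ(0)`, a word of length `2 ^ n > n`. -/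
def thueMorse : InfWord := fun n =>
  (phi^[n] [0])[n]'(by rw [length_phi_iterate]; exact Nat.lt_two_pow_self)

theorem phi_append (u v : Word) : phi (u ++ v) = phi u ++ phi v := by
  simp [phi]

theorem phi_iterate_prefix_succ (n : ℕ) : phi^[n] [0] <+: phi^[n + 1] [0] := by
  induction n with
  | zero => exact ⟨[1], rfl⟩
  | succ n ih =>
    obtain ⟨s, hs⟩ := ih
    rw [Function.iterate_succ_apply' phi n, Function.iterate_succ_apply' phi (n + 1), ← hs,
      phi_append]
    exact ⟨phi s, rfl⟩

theorem phi_iterate_prefix {m n : ℕ} (h : m ≤ n) : phi^[m] [0] <+: phi^[n] [0] := by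
  induction n, h using Nat.le_induction with
  | base => exact List.prefix_rfl
  | succ n _ ih => exact ih.trans (phi_iterate_prefix_succ n)

/-- Each `φᵐ(0)` is a prefix of the Thue–Morse word. -/
theorem factorAt_thueMorse (m : ℕ) : factorAt thueMorse 0 (2 ^ m) = phi^[m] [0] := by
  apply List.ext_getElem
  · simp [factorAt, length_phi_iterate]
  · intro i h₁ h₂
    simp only [factorAt, List.getElem_map, List.getElem_range, zero_add, thueMorse]
    rcases le_total i m with h | h
    · exact (phi_iterate_prefix h).getElem _
    · exact ((phi_iterate_prefix h).getElem _).symm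

theorem thueMorse_zero : thueMorse 0 = 0 := rfl

/-- The Thue–Morse word is a fixed point of `φ`: the image of its prefix of length `n` is its
prefix of length `2 * n`. -/
theorem phi_factorAt_thueMorse (n : ℕ) :
    phi (factorAt thueMorse 0 n) = factorAt thueMorse 0 (2 * n) := by
  have hpre : ∀ {a b : ℕ}, a ≤ b → factorAt thueMorse 0 a <+: factorAt thueMorse 0 b := by
    intro a b hab
    obtain ⟨c, rfl⟩ := Nat.exists_eq_add_of_le hab
    simp [factorAt, List.range_add]
  have hn : n ≤ 2 ^ n := Nat.lt_two_pow_self.le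
  have h₁ : phi (factorAt thueMorse 0 n) <+: factorAt thueMorse 0 (2 ^ (n + 1)) := by
    obtain ⟨s, hs⟩ := hpre hn
    rw [factorAt_thueMorse, Function.iterate_succ_apply', ← factorAt_thueMorse, ← hs, phi_append]
    exact ⟨phi s, rfl⟩
  have h₂ : factorAt thueMorse 0 (2 * n) <+: factorAt thueMorse 0 (2 ^ (n + 1)) :=
    hpre (by rw [pow_succ']; omega)
  refine (List.prefix_of_prefix_length_le h₁ h₂ ?_).eq_of_length ?_ <;>
    simp [length_phi, factorAt]

end ThueMorse

namespace ThueMorse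

open Polynomial

/-! ### Binomial coefficients of words -/

/-! The sign polynomial of a word is `∑ ± (1 + X) ^ i`, the sign being given by the letter at
position `i`. Its coefficient of degree `j` is a combination of binomial coefficients by words of
length at most `j + 1`, so `k`-binomially equivalent words have sign polynomials congruent modulo `X
^ k`. For factors of the Thue–Morse word of equal length the converse holds
(`signEquiv_iff_binomEquiv`), and the `k`-binomial relation becomes a congruence in one variable.

Applying `φ` to words of equal length raises the order of binomial equivalence by one
(`BinomEquiv.phi`) and that of the congruence by exactly one (`pow_succ_dvd_signPoly_phi_iff`). A
factor is a `φ`-image with at most one letter cut off at each end. From length `4` on, the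
coefficients of degree `0` and `1` force congruent factors to start at the same parity and to have
the same cut letters (`not_signEquiv_even`, `not_signEquiv_odd`, `signEquiv_odd_even`). Hence order
`k + 1` reduces to order `k` at about half the length. This yields the converse, and equality of
congruent factors of length below `2 ^ k` (`SignEquiv.fac_eq`).

For larger lengths, the reduction must remember cut letters, so classes are also counted with the
first letter, the last letter or both recorded. These counts obey a closed recurrence
(`numClasses_even`, `numClasses_odd`) that starts at `k = 1` (`numClasses_one`). -/

theorem binom_nil_right (u : Word) : binom u [] = 1 := by
  induction u with
  | nil => rfl
  | cons a u ih =>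
    unfold binom at *
    rw [List.sublists'_cons, List.count_append, ih, Nat.add_eq_left, List.count_eq_zero]
    simp

theorem binom_nil_cons (b : Letter) (x : Word) : binom [] (b :: x) = 0 := by
  simp [binom]

theorem binom_cons_cons (a : Letter) (u : Word) (b : Letter) (x : Word) :
    binom (a :: u) (b :: x) = binom u (b :: x) + if a = b then binom u x else 0 := by
  unfold binom
  rw [List.sublists'_cons, List.count_append]
  congr 1
  split_ifs with h
  · subst h
    exact List.count_map_of_injective _ _ List.cons_injective _
  · rw [List.count_eq_zero]
    simp [h]

theorem binom_reverse (u x : Word) : binom u.reverse x.reverse = binom u x := by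
  unfold binom
  rw [List.sublists'_reverse, List.count_map_of_injective _ _ List.reverse_injective,
    (List.sublists_perm_sublists' u).count_eq]

/-- `k`-binomial equivalence of words. -/
def BinomEquiv (k : ℕ) (u v : Word) : Prop :=
  ∀ x : Word, x.length ≤ k → binom u x = binom v x

theorem BinomEquiv.reverse {k : ℕ} {u v : Word} (h : BinomEquiv k u v) :
    BinomEquiv k u.reverse v.reverse := by
  intro x hx
  rw [← x.reverse_reverse, binom_reverse, binom_reverse]
  exact h _ (by simpa using hx)

theorem binomEquiv_cons_iff {k : ℕ} (a : Letter) {u v : Word} :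
    BinomEquiv k (a :: u) (a :: v) ↔ BinomEquiv k u v := by
  constructor
  · intro h x
    -- Cancellation goes by the length of the tested word: the extra term in `binom_cons_cons` tests
    -- a shorter one.
    induction x with
    | nil => simp [binom_nil_right]
    | cons b x ih =>
      intro hx
      have h₁ := h (b :: x) hx
      have h₂ := ih (by simp at hx; omega)
      rw [binom_cons_cons, binom_cons_cons, h₂] at h₁
      omega
  · intro h x hx
    cases x with
    | nil => simp [binom_nil_right]
    | cons b x =>
      rw [binom_cons_cons, binom_cons_cons, h _ hx, h x (by simp at hx; omega)]

theorem binomEquiv_concat_iff {k : ℕ} (a : Letter) {u v : Word} :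
    BinomEquiv k (u ++ [a]) (v ++ [a]) ↔ BinomEquiv k u v := by
  constructor
  · intro h
    have h' := h.reverse
    simp only [List.reverse_append, List.reverse_singleton, List.singleton_append] at h'
    simpa using ((binomEquiv_cons_iff a).1 h').reverse
  · intro h
    simpa using ((binomEquiv_cons_iff a).2 h.reverse).reverse

/-! ### Functions determined by binomial coefficients -/

/-- The span of the functions `u ↦ binom u y` for words `y` of length at most `k`. -/
def binomSpan (k : ℕ) : Submodule ℤ (Word → ℤ) :=
  Submodule.span ℤ {f | ∃ y : Word, y.length ≤ k ∧ f = fun u => (binom u y : ℤ)}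

/-- The span of the functions `u ↦ (|u| choose j)`. -/
def lengthSpan : Submodule ℤ (Word → ℤ) :=
  Submodule.span ℤ {f | ∃ j : ℕ, f = fun u => (u.length.choose j : ℤ)}

theorem binom_mem_binomSpan {k : ℕ} {y : Word} (hy : y.length ≤ k) :
    (fun u => (binom u y : ℤ)) ∈ binomSpan k :=
  Submodule.subset_span ⟨y, hy, rfl⟩

theorem one_mem_binomSpan (k : ℕ) : (fun _ => 1 : Word → ℤ) ∈ binomSpan k := by
  simpa [binom_nil_right] using binom_mem_binomSpan (k := k) (y := []) (by simp)

theorem binomSpan_mono {k l : ℕ} (h : k ≤ l) : binomSpan k ≤ binomSpan l :=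
  Submodule.span_mono fun _ ⟨y, hy, hf⟩ => ⟨y, hy.trans h, hf⟩

/-- The sum of `r u` over all factorizations `w = v a u` of a word `w`. -/
def sumAfterAux (a : Letter) (r : Word → ℤ) : Word → ℤ
  | [] => 0
  | b :: u => sumAfterAux a r u + if b = a then r u else 0

/-- `sumAfterAux` as a linear map. -/
def sumAfter (a : Letter) : (Word → ℤ) →ₗ[ℤ] (Word → ℤ) where
  toFun := sumAfterAux a
  map_add' r s := by
    funext u
    induction u with
    | nil => simp [sumAfterAux]
    | cons b u ih =>
      simp only [Pi.add_apply, sumAfterAux] at *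
      rw [ih]
      split_ifs <;> ring
  map_smul' c r := by
    funext u
    induction u with
    | nil => simp [sumAfterAux]
    | cons b u ih =>
      simp only [Pi.smul_apply, sumAfterAux, RingHom.id_apply, smul_eq_mul] at *
      rw [ih]
      split_ifs <;> ring

theorem sumAfter_nil (a : Letter) (r : Word → ℤ) : sumAfter a r [] = 0 := rfl

theorem sumAfter_cons (a b : Letter) (r : Word → ℤ) (u : Word) :
    sumAfter a r (b :: u) = sumAfter a r u + if b = a then r u else 0 := rfl

/-- Occurrences of `a :: y` are sorted by the position of their first letter. -/
theorem sumAfter_binom (a : Letter) (y : Word) :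
    sumAfter a (fun u => (binom u y : ℤ)) = fun u => (binom u (a :: y) : ℤ) := by
  funext u
  induction u with
  | nil => simp [sumAfter_nil, binom_nil_cons]
  | cons b u ih =>
    rw [sumAfter_cons, ih, binom_cons_cons]
    split_ifs <;> simp

theorem sumAfter_mem_binomSpan (a : Letter) {k : ℕ} {r : Word → ℤ} (hr : r ∈ binomSpan k) :
    sumAfter a r ∈ binomSpan (k + 1) := by
  suffices h : binomSpan k ≤ (binomSpan (k + 1)).comap (sumAfter a) from h hr
  refine Submodule.span_le.2 ?_
  rintro _ ⟨y, hy, rfl⟩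
  simp only [SetLike.mem_coe, Submodule.mem_comap, sumAfter_binom]
  exact binom_mem_binomSpan (by simpa using hy)

/-- The hockey-stick identity: summing over both letters is summing over all proper suffixes. -/
theorem sumAfter_length (j : ℕ) :
    (sumAfter 0 + sumAfter 1) (fun u => (u.length.choose j : ℤ)) =
      fun u => (u.length.choose (j + 1) : ℤ) := by
  funext u
  induction u with
  | nil => simp [sumAfter_nil]
  | cons b u ih =>
    simp only [LinearMap.add_apply, Pi.add_apply, sumAfter_cons, List.length_cons] at *
    rw [Nat.choose_succ_succ, Nat.cast_add, ← ih]
    fin_cases b <;> simp <;> ring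

theorem sumAfter_mem_lengthSpan {r : Word → ℤ} (hr : r ∈ lengthSpan) :
    (sumAfter 0 + sumAfter 1) r ∈ lengthSpan := by
  suffices h : lengthSpan ≤ lengthSpan.comap (sumAfter 0 + sumAfter 1) from h hr
  refine Submodule.span_le.2 ?_
  rintro _ ⟨j, rfl⟩
  simp only [SetLike.mem_coe, Submodule.mem_comap, sumAfter_length]
  exact Submodule.subset_span ⟨j + 1, rfl⟩

/-- A function on words is recovered from its differences `h (a u) - h u`. -/
theorem eq_sumAfter {h : Word → ℤ} {r : Letter → Word → ℤ} (h₀ : h [] = 0)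
    (hr : ∀ a u, h (a :: u) = h u + r a u) : h = sumAfter 0 (r 0) + sumAfter 1 (r 1) := by
  funext u
  induction u with
  | nil => simp [h₀, sumAfter_nil]
  | cons b u ih =>
    rw [hr, ih]
    simp only [Pi.add_apply, sumAfter_cons]
    fin_cases b <;> simp <;> ring

theorem BinomEquiv.eq_of_mem {k : ℕ} {u v : Word} (h : BinomEquiv k u v) {f : Word → ℤ}
    (hf : f ∈ binomSpan k) : f u = f v := by
  suffices H : binomSpan k ≤ LinearMap.ker
      ((LinearMap.proj u : (Word → ℤ) →ₗ[ℤ] ℤ) - LinearMap.proj v) from sub_eq_zero.1 (H hf)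
  refine Submodule.span_le.2 ?_
  rintro _ ⟨y, hy, rfl⟩
  simp [h y hy]

theorem eq_of_mem_lengthSpan {u v : Word} (h : u.length = v.length) {f : Word → ℤ}
    (hf : f ∈ lengthSpan) : f u = f v := by
  suffices H : lengthSpan ≤ LinearMap.ker
      ((LinearMap.proj u : (Word → ℤ) →ₗ[ℤ] ℤ) - LinearMap.proj v) from sub_eq_zero.1 (H hf)
  refine Submodule.span_le.2 ?_
  rintro _ ⟨j, rfl⟩
  simp [h]

/-! ### Binomial coefficients of images under the morphism -/

theorem phi_cons (a : Letter) (u : Word) : phi (a :: u) = a :: (1 - a) :: phi u := by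
  fin_cases a <;> rfl

theorem binom_phi_singleton (b : Letter) :
    (fun u => (binom (phi u) [b] : ℤ)) =
      (sumAfter 0 + sumAfter 1) (fun u => (binom (phi u) [] : ℤ)) := by
  refine eq_sumAfter (h := fun u => (binom (phi u) [b] : ℤ))
    (r := fun _ u => (binom (phi u) [] : ℤ)) rfl fun a u => ?_
  simp only [phi_cons, binom_cons_cons, binom_nil_right]
  fin_cases a <;> fin_cases b <;> simp

/-- Each block of `phi u` contains `b` exactly once, and an occurrence is sorted by the block of its
first letter. Either `c :: y` lies in later blocks, or the block is `b (1 - b)` and also supplies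
`c`, leaving `y`. -/
theorem binom_phi_cons_cons (b c : Letter) (y : Word) :
    (fun u => (binom (phi u) (b :: c :: y) : ℤ)) =
      (sumAfter 0 + sumAfter 1) (fun u => (binom (phi u) (c :: y) : ℤ)) +
        if c = 1 - b then sumAfter b (fun u => (binom (phi u) y : ℤ)) else 0 := by
  rw [eq_sumAfter (h := fun u => (binom (phi u) (b :: c :: y) : ℤ))
    (r := fun a u => (binom (phi u) (c :: y) : ℤ) +
      if a = b ∧ c = 1 - b then (binom (phi u) y : ℤ) else 0) rfl ?_]
  · funext u
    induction u with
    | nil => split_ifs <;> simp [sumAfter_nil]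
    | cons a u ih =>
      revert ih
      fin_cases b <;> fin_cases c <;> fin_cases a <;> simp [sumAfter_cons] <;> intro ih <;> linarith
  · intro a u
    simp only [phi_cons, binom_cons_cons]
    fin_cases b <;> fin_cases c <;> fin_cases a <;> simp

theorem binom_phi_mem_binomSpan (x : Word) :
    (fun u => (binom (phi u) x : ℤ)) ∈ binomSpan x.length := by
  induction x using List.twoStepInduction with
  | nil => simpa [binom_nil_right] using one_mem_binomSpan 0
  | singleton b =>
    rw [binom_phi_singleton]
    simp only [binom_nil_right, LinearMap.add_apply, Nat.cast_one]
    exact add_mem (sumAfter_mem_binomSpan 0 (one_mem_binomSpan 0))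
      (sumAfter_mem_binomSpan 1 (one_mem_binomSpan 0))
  | cons_cons b c y ih₁ ih₂ =>
    rw [binom_phi_cons_cons]
    refine add_mem (add_mem (sumAfter_mem_binomSpan 0 (ih₂ c)) (sumAfter_mem_binomSpan 1 (ih₂ c))) ?_
    split_ifs
    · exact binomSpan_mono (by simp) (sumAfter_mem_binomSpan b ih₁)
    · exact zero_mem _

/-- The gain of one degree comes from the last term of `binom_phi_cons_cons`: two letters are
removed and `sumAfter` restores only one. The other term sums over both letters, which is what keeps
functions of the length among themselves. -/
theorem binom_phi_mem_sup (x : Word) :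
    (fun u => (binom (phi u) x : ℤ)) ∈ binomSpan (x.length - 1) ⊔ lengthSpan := by
  have h₁ : (fun u => (binom (phi u) [] : ℤ)) ∈ lengthSpan := by
    simp only [binom_nil_right]
    exact Submodule.subset_span ⟨0, by simp⟩
  induction x using List.twoStepInduction with
  | nil => exact Submodule.mem_sup_right h₁
  | singleton b =>
    rw [binom_phi_singleton]
    exact Submodule.mem_sup_right (sumAfter_mem_lengthSpan h₁)
  | cons_cons b c y ih₁ ih₂ =>
    rw [binom_phi_cons_cons]
    refine add_mem ?_ ?_
    · obtain ⟨f, hf, g, hg, hfg⟩ := Submodule.mem_sup.1 (ih₂ c)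
      rw [← hfg, map_add]
      exact add_mem (Submodule.mem_sup_left
        (add_mem (sumAfter_mem_binomSpan 0 hf) (sumAfter_mem_binomSpan 1 hf)))
        (Submodule.mem_sup_right (sumAfter_mem_lengthSpan hg))
    · split_ifs
      · exact Submodule.mem_sup_left (sumAfter_mem_binomSpan b (binom_phi_mem_binomSpan y))
      · exact zero_mem _

theorem BinomEquiv.phi {k : ℕ} {u v : Word} (h : BinomEquiv k u v) (hl : u.length = v.length) :
    BinomEquiv (k + 1) (phi u) (phi v) := by
  intro x hx
  obtain ⟨f, hf, g, hg, hfg⟩ := Submodule.mem_sup.1 (binom_phi_mem_sup x)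
  have e := h.eq_of_mem (binomSpan_mono (by omega) hf)
  have e' := eq_of_mem_lengthSpan hl hg
  have hu := congrFun hfg u
  have hv := congrFun hfg v
  simp only [Pi.add_apply] at hu hv
  exact_mod_cast (by rw [← hu, ← hv, e, e'] : (binom (ThueMorse.phi u) x : ℤ) = binom (ThueMorse.phi v) x)

/-! ### The sign polynomial of a word -/

/-- The sign `1` or `-1` of a letter. -/
def sign (a : Letter) : ℤ := if a = 0 then 1 else -1

theorem sign_eq_or (a : Letter) : sign a = 1 ∨ sign a = -1 := by
  fin_cases a <;> simp [sign]

theorem sign_one_sub (a : Letter) : sign (1 - a) = -sign a := by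
  fin_cases a <;> simp [sign]

theorem sign_injective : Function.Injective sign := by
  intro a b
  fin_cases a <;> fin_cases b <;> simp [sign]

/-- The polynomial `∑ i, sign uᵢ * (1 + X) ^ i` of a word `u`. -/
noncomputable def signPoly : Word → ℤ[X]
  | [] => 0
  | a :: u => C (sign a) + (1 + X) * signPoly u

theorem signPoly_concat (u : Word) (a : Letter) :
    signPoly (u ++ [a]) = signPoly u + (1 + X) ^ u.length * C (sign a) := by
  induction u with
  | nil => simp [signPoly]
  | cons b u ih =>
    simp only [List.cons_append, signPoly, ih, List.length_cons]
    ring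

/-- A letter at position `i` becomes two opposite letters at `2i` and `2i + 1`, contributing `(1 +
X) ^ (2i) * (1 - (1 + X))` up to sign, and `(1 + X) ^ 2 = 1 + (X ^ 2 + 2 * X)`. -/
theorem signPoly_phi (u : Word) :
    signPoly (phi u) = -X * (signPoly u).comp (X ^ 2 + 2 * X) := by
  induction u with
  | nil => simp [phi, signPoly]
  | cons a u ih =>
    simp only [phi_cons, signPoly, ih, sign_one_sub, add_comp, mul_comp, C_comp, one_comp, X_comp,
      C_neg]
    ring

theorem coeff_zero_signPoly_cons (a : Letter) (u : Word) :
    (signPoly (a :: u)).coeff 0 = sign a + (signPoly u).coeff 0 := by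
  simp [signPoly, add_mul]

theorem coeff_succ_signPoly_cons (a : Letter) (u : Word) (j : ℕ) :
    (signPoly (a :: u)).coeff (j + 1) = (signPoly u).coeff (j + 1) + (signPoly u).coeff j := by
  rw [signPoly, coeff_add, coeff_C_succ, add_mul, one_mul, coeff_add, coeff_X_mul, zero_add]

theorem coeff_signPoly_mem_binomSpan (j : ℕ) :
    (fun u => (signPoly u).coeff j) ∈ binomSpan (j + 1) := by
  induction j with
  | zero =>
    rw [eq_sumAfter (h := fun u => (signPoly u).coeff 0) (r := fun a _ => sign a)
      (by simp [signPoly]) fun a u => by rw [coeff_zero_signPoly_cons, add_comm]]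
    have h : ∀ a : Letter, (fun _ => sign a : Word → ℤ) ∈ binomSpan 0 := fun a => by
      convert (binomSpan 0).smul_mem (sign a) (one_mem_binomSpan 0) using 1
      funext
      simp
    exact add_mem (sumAfter_mem_binomSpan 0 (h 0)) (sumAfter_mem_binomSpan 1 (h 1))
  | succ j ih =>
    rw [eq_sumAfter (h := fun u => (signPoly u).coeff (j + 1))
      (r := fun _ u => (signPoly u).coeff j)
      (by simp [signPoly]) fun a u => coeff_succ_signPoly_cons a u j]
    exact add_mem (sumAfter_mem_binomSpan 0 ih) (sumAfter_mem_binomSpan 1 ih)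

theorem BinomEquiv.pow_dvd {k : ℕ} {u v : Word} (h : BinomEquiv k u v) :
    X ^ k ∣ signPoly u - signPoly v := by
  rw [X_pow_dvd_iff]
  intro j hj
  rw [coeff_sub, sub_eq_zero]
  exact h.eq_of_mem (f := fun u => (signPoly u).coeff j)
    (binomSpan_mono hj (coeff_signPoly_mem_binomSpan j))

theorem coeff_zero_signPoly (u : Word) :
    (signPoly u).coeff 0 = (binom u [0] : ℤ) - binom u [1] := by
  induction u with
  | nil => simp [signPoly, binom_nil_cons]
  | cons a u ih =>
    rw [coeff_zero_signPoly_cons, ih, binom_cons_cons, binom_cons_cons]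
    fin_cases a <;> simp [sign, binom_nil_right] <;> ring

theorem length_eq_binom (u : Word) : (u.length : ℤ) = (binom u [0] : ℤ) + binom u [1] := by
  induction u with
  | nil => simp [binom_nil_cons]
  | cons a u ih =>
    rw [List.length_cons, Nat.cast_succ, ih, binom_cons_cons, binom_cons_cons]
    fin_cases a <;> simp [binom_nil_right] <;> ring

theorem binomEquiv_one_of_coeff_zero {u v : Word} (hl : u.length = v.length)
    (h : (signPoly u).coeff 0 = (signPoly v).coeff 0) : BinomEquiv 1 u v := by
  intro x hx
  have h₁ := length_eq_binom u
  have h₂ := length_eq_binom v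
  rw [coeff_zero_signPoly, coeff_zero_signPoly] at h
  rw [hl] at h₁
  match x, hx with
  | [], _ => rw [binom_nil_right, binom_nil_right]
  | [b], _ =>
    fin_cases b <;> simp <;> omega

/-- The first two coefficients of the sign polynomial determine words of length at most `3`. -/
theorem eq_of_coeff_signPoly_eq {u v : Word} (hl : u.length = v.length) (hu : u.length ≤ 3)
    (h₀ : (signPoly u).coeff 0 = (signPoly v).coeff 0)
    (h₁ : (signPoly u).coeff 1 = (signPoly v).coeff 1) : u = v := by
  have hc : ∀ (a : Letter) (u : Word),
      (signPoly (a :: u)).coeff 1 = (signPoly u).coeff 1 + (signPoly u).coeff 0 :=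
    fun a u => coeff_succ_signPoly_cons a u 0
  have hn : ∀ j, (signPoly []).coeff j = 0 := by simp [signPoly]
  have key : ∀ a b : Letter, sign a = sign b → a = b := fun a b h => sign_injective h
  match u, v, hl, hu with
  | [], [], _, _ => rfl
  | [a], [a'], _, _ =>
    simp only [coeff_zero_signPoly_cons, hc, hn] at h₀ h₁
    rw [key a a' (by omega)]
  | [a, b], [a', b'], _, _ =>
    simp only [coeff_zero_signPoly_cons, hc, hn] at h₀ h₁
    rw [key a a' (by omega), key b b' (by omega)]
  | [a, b, c], [a', b', c'], _, _ =>
    simp only [coeff_zero_signPoly_cons, hc, hn] at h₀ h₁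
    -- Coefficient `1` is `b + 2c` in signs, which takes distinct values on the four choices of `b`
    -- and `c`.
    have := sign_eq_or a
    have := sign_eq_or a'
    have := sign_eq_or b
    have := sign_eq_or b'
    have := sign_eq_or c
    have := sign_eq_or c'
    rw [key a a' (by omega), key b b' (by omega), key c c' (by omega)]

/-! ### Divisibility by powers of `X` -/

theorem not_X_dvd_of_coeff_zero {p : ℤ[X]} (h : p.coeff 0 ≠ 0) : ¬ X ∣ p :=
  fun hp => h (X_dvd_iff.1 hp)

theorem pow_dvd_mul_iff {k : ℕ} {p q : ℤ[X]} (h : p.coeff 0 ≠ 0) : X ^ k ∣ p * q ↔ X ^ k ∣ q :=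
  ⟨prime_X.pow_dvd_of_dvd_mul_left k (not_X_dvd_of_coeff_zero h), fun hq => hq.mul_left p⟩

/-- `X ^ 2 + 2 * X = X * (X + 2)` vanishes to order exactly one at `0`, so substituting it preserves
the order of vanishing. -/
theorem pow_dvd_comp_iff {k : ℕ} (p : ℤ[X]) :
    X ^ k ∣ p.comp (X ^ 2 + 2 * X) ↔ X ^ k ∣ p := by
  induction k generalizing p with
  | zero => simp
  | succ k ih =>
    have h₀ : X ∣ p.comp (X ^ 2 + 2 * X) ↔ X ∣ p := by
      rw [X_dvd_iff, X_dvd_iff, coeff_zero_eq_eval_zero, coeff_zero_eq_eval_zero, eval_comp]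
      simp
    by_cases hp : X ∣ p
    · obtain ⟨q, rfl⟩ := hp
      have e : (X * q).comp (X ^ 2 + 2 * X) = X * ((X + 2) * q.comp (X ^ 2 + 2 * X)) := by
        rw [mul_comp, X_comp]
        ring
      rw [e, pow_succ', mul_dvd_mul_iff_left X_ne_zero, mul_dvd_mul_iff_left X_ne_zero,
        pow_dvd_mul_iff (by simp), ih]
    · constructor
      · intro h
        exact absurd (h₀.1 ((dvd_pow_self X k.succ_ne_zero).trans h)) hp
      · intro h
        exact absurd ((dvd_pow_self X k.succ_ne_zero).trans h) hp

theorem pow_succ_dvd_signPoly_phi_iff {k : ℕ} {u v : Word} :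
    X ^ (k + 1) ∣ signPoly (phi u) - signPoly (phi v) ↔ X ^ k ∣ signPoly u - signPoly v := by
  rw [signPoly_phi, signPoly_phi, ← pow_dvd_comp_iff (signPoly u - signPoly v), sub_comp,
    ← mul_sub, neg_mul, dvd_neg, pow_succ', mul_dvd_mul_iff_left X_ne_zero]

theorem pow_dvd_signPoly_cons_iff {k : ℕ} (a : Letter) {u v : Word} :
    X ^ k ∣ signPoly (a :: u) - signPoly (a :: v) ↔ X ^ k ∣ signPoly u - signPoly v := by
  rw [signPoly, signPoly, add_sub_add_left_eq_sub, ← mul_sub, pow_dvd_mul_iff (by simp)]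

theorem pow_dvd_signPoly_concat_iff {k : ℕ} (a : Letter) {u v : Word} (h : u.length = v.length) :
    X ^ k ∣ signPoly (u ++ [a]) - signPoly (v ++ [a]) ↔ X ^ k ∣ signPoly u - signPoly v := by
  rw [signPoly_concat, signPoly_concat, h, add_sub_add_right_eq_sub]

theorem coeff_eq_of_pow_dvd {k j : ℕ} (hj : j < k) {p q : ℤ[X]} (h : X ^ k ∣ p - q) :
    p.coeff j = q.coeff j := by
  rw [← sub_eq_zero, ← coeff_sub]
  exact X_pow_dvd_iff.1 h j hj

theorem coeff_zero_signPoly_concat (u : Word) (a : Letter) :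
    (signPoly (u ++ [a])).coeff 0 = (signPoly u).coeff 0 + sign a := by
  simp [signPoly_concat, coeff_zero_eq_eval_zero]

theorem coeff_one_signPoly_concat (u : Word) (a : Letter) :
    (signPoly (u ++ [a])).coeff 1 = (signPoly u).coeff 1 + u.length * sign a := by
  simp [signPoly_concat, coeff_one_add_X_pow]

theorem coeff_zero_signPoly_phi (u : Word) : (signPoly (phi u)).coeff 0 = 0 := by
  simp [signPoly_phi]

theorem coeff_one_signPoly_phi (u : Word) :
    (signPoly (phi u)).coeff 1 = -(signPoly u).coeff 0 := by
  rw [signPoly_phi, neg_mul, coeff_neg, coeff_X_mul, coeff_zero_eq_eval_zero, eval_comp,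
    coeff_zero_eq_eval_zero]
  simp

/-! ### Factors of the Thue–Morse word -/

theorem length_factorAt (x : InfWord) (i n : ℕ) : (factorAt x i n).length = n := by
  simp [factorAt]

theorem factorAt_succ (x : InfWord) (i n : ℕ) :
    factorAt x i (n + 1) = x i :: factorAt x (i + 1) n := by
  simp only [factorAt, List.range_succ_eq_map, List.map_cons, List.map_map, add_zero]
  congr 1
  refine List.map_congr_left fun j _ => ?_
  simp [Nat.add_comm, Nat.add_left_comm]

theorem factorAt_succ' (x : InfWord) (i n : ℕ) :
    factorAt x i (n + 1) = factorAt x i n ++ [x (i + n)] := by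
  simp [factorAt, List.range_succ]

theorem phi_singleton (a : Letter) : phi [a] = [a, 1 - a] := phi_cons a []

theorem thueMorse_two_mul_and (i : ℕ) :
    thueMorse (2 * i) = thueMorse i ∧ thueMorse (2 * i + 1) = 1 - thueMorse i := by
  have h := phi_factorAt_thueMorse (i + 1)
  rw [factorAt_succ', phi_append, phi_factorAt_thueMorse, show 2 * (i + 1) = 2 * i + 1 + 1 by ring,
    factorAt_succ', factorAt_succ', List.append_assoc, List.append_cancel_left_eq] at h
  rw [phi_singleton] at h
  simp only [List.singleton_append, List.cons.injEq, and_true, zero_add] at h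
  exact ⟨h.1.symm, h.2.symm⟩

theorem thueMorse_two_mul (i : ℕ) : thueMorse (2 * i) = thueMorse i :=
  (thueMorse_two_mul_and i).1

theorem thueMorse_two_mul_add_one (i : ℕ) : thueMorse (2 * i + 1) = 1 - thueMorse i :=
  (thueMorse_two_mul_and i).2

/-- The factor of length `n` of the Thue–Morse word at position `i`. -/
abbrev fac (i n : ℕ) : Word := factorAt thueMorse i n

theorem phi_fac (i m : ℕ) : phi (fac i m) = fac (2 * i) (2 * m) := by
  induction m with
  | zero => rfl
  | succ m ih =>
    rw [fac, factorAt_succ', phi_append, ih, show 2 * (m + 1) = 2 * m + 1 + 1 by ring, fac, fac,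
      factorAt_succ', factorAt_succ', List.append_assoc, List.append_cancel_left_eq,
      show 2 * i + 2 * m = 2 * (i + m) by ring, show 2 * i + (2 * m + 1) = 2 * (i + m) + 1 by ring,
      thueMorse_two_mul, thueMorse_two_mul_add_one, phi_singleton, List.singleton_append]

theorem phi_fac_eq_concat (i m : ℕ) :
    phi (fac i (m + 1)) = fac (2 * i) (2 * m + 1) ++ [1 - thueMorse (i + m)] := by
  rw [phi_fac, show 2 * (m + 1) = 2 * m + 1 + 1 by ring, fac, factorAt_succ',
    show 2 * i + (2 * m + 1) = 2 * (i + m) + 1 by ring, thueMorse_two_mul_add_one]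

theorem phi_fac_eq_cons (i m : ℕ) :
    phi (fac i (m + 1)) = thueMorse i :: fac (2 * i + 1) (2 * m + 1) := by
  rw [phi_fac, show 2 * (m + 1) = 2 * m + 1 + 1 by ring, fac, factorAt_succ, thueMorse_two_mul]

theorem phi_fac_eq_cons_concat (i m : ℕ) :
    phi (fac i (m + 1)) =
      thueMorse i :: (fac (2 * i + 1) (2 * m) ++ [1 - thueMorse (i + m)]) := by
  rw [phi_fac_eq_cons, fac, factorAt_succ', show 2 * i + 1 + 2 * m = 2 * (i + m) + 1 by ring,
    thueMorse_two_mul_add_one]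

/-! ### Coefficients of the sign polynomials of factors -/

/-- The sum of the signs of the letters of a factor. -/
noncomputable def signSum (i n : ℕ) : ℤ := (signPoly (fac i n)).coeff 0

theorem signSum_even_even (i m : ℕ) : signSum (2 * i) (2 * m) = 0 := by
  rw [signSum, ← phi_fac, coeff_zero_signPoly_phi]

theorem signSum_even_odd (i m : ℕ) :
    signSum (2 * i) (2 * m + 1) = sign (thueMorse (i + m)) := by
  have h := coeff_zero_signPoly_phi (fac i (m + 1))
  rw [phi_fac_eq_concat, coeff_zero_signPoly_concat, sign_one_sub] at h
  rw [signSum]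
  linarith

theorem signSum_odd_odd (i m : ℕ) :
    signSum (2 * i + 1) (2 * m + 1) = -sign (thueMorse i) := by
  have h := coeff_zero_signPoly_phi (fac i (m + 1))
  rw [phi_fac_eq_cons, coeff_zero_signPoly_cons] at h
  rw [signSum]
  linarith

/-- The factor is completed to a `φ`-image, whose signs sum to `0`; the completing letters are read
off from the preimage. -/
theorem signSum_odd_even (i m : ℕ) :
    signSum (2 * i + 1) (2 * m) = sign (thueMorse (i + m)) - sign (thueMorse i) := by
  have h := coeff_zero_signPoly_phi (fac i (m + 1))
  rw [phi_fac_eq_cons_concat, coeff_zero_signPoly_cons, coeff_zero_signPoly_concat,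
    sign_one_sub] at h
  rw [signSum]
  linarith

theorem coeff_one_even_even (i m : ℕ) :
    (signPoly (fac (2 * i) (2 * m))).coeff 1 = -signSum i m := by
  rw [signSum, ← phi_fac, coeff_one_signPoly_phi]

theorem coeff_one_even_odd (i m : ℕ) :
    (signPoly (fac (2 * i) (2 * m + 1))).coeff 1 =
      (2 * m + 1) * sign (thueMorse (i + m)) - signSum i (m + 1) := by
  have h := coeff_one_signPoly_phi (fac i (m + 1))
  rw [phi_fac_eq_concat, coeff_one_signPoly_concat, sign_one_sub, length_factorAt] at h
  push_cast at h
  rw [signSum]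
  linarith

theorem coeff_one_odd_odd (i m : ℕ) :
    (signPoly (fac (2 * i + 1) (2 * m + 1))).coeff 1 =
      sign (thueMorse i) - signSum i (m + 1) := by
  have h := coeff_one_signPoly_phi (fac i (m + 1))
  have h' := signSum_odd_odd i m
  rw [signSum] at h'
  rw [phi_fac_eq_cons, coeff_succ_signPoly_cons, h'] at h
  rw [signSum]
  linarith

theorem coeff_one_odd_even (i m : ℕ) :
    (signPoly (fac (2 * i + 1) (2 * m))).coeff 1 =
      2 * m * sign (thueMorse (i + m)) + sign (thueMorse i) - signSum i (m + 1) := by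
  have h := coeff_one_signPoly_phi (fac i (m + 1))
  have h' := signSum_odd_even i m
  rw [signSum] at h'
  rw [phi_fac_eq_cons_concat, coeff_succ_signPoly_cons, coeff_one_signPoly_concat,
    coeff_zero_signPoly_concat, h', sign_one_sub, length_factorAt] at h
  push_cast at h
  rw [signSum]
  linarith

/-- Sign sums stay bounded, whereas the coefficients of degree one carry terms growing with the
length; this contrast exposes parities and cut letters. -/
theorem signSum_le_two (i n : ℕ) : -2 ≤ signSum i n ∧ signSum i n ≤ 2 := by
  obtain ⟨i, rfl | rfl⟩ := i.even_or_odd' <;> obtain ⟨m, rfl | rfl⟩ := n.even_or_odd'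
  · simp [signSum_even_even]
  · rw [signSum_even_odd]
    have := sign_eq_or (thueMorse (i + m))
    omega
  · rw [signSum_odd_even]
    have := sign_eq_or (thueMorse (i + m))
    have := sign_eq_or (thueMorse i)
    omega
  · rw [signSum_odd_odd]
    have := sign_eq_or (thueMorse i)
    omega

/-! ### Sign equivalence of factors -/

/-- The sign polynomials of the factors of length `n` at `i` and `j` agree up to degree `< k`. -/
def SignEquiv (k n i j : ℕ) : Prop := X ^ k ∣ signPoly (fac i n) - signPoly (fac j n)

theorem SignEquiv.symm {k n i j : ℕ} (h : SignEquiv k n i j) : SignEquiv k n j i := by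
  rw [SignEquiv] at *
  rwa [dvd_sub_comm]

theorem SignEquiv.signSum_eq {k n i j : ℕ} (h : SignEquiv k n i j) (hk : 0 < k) :
    signSum i n = signSum j n :=
  coeff_eq_of_pow_dvd hk h

theorem SignEquiv.coeff_one_eq {k n i j : ℕ} (h : SignEquiv (k + 1) n i j) (hk : 0 < k) :
    (signPoly (fac i n)).coeff 1 = (signPoly (fac j n)).coeff 1 :=
  coeff_eq_of_pow_dvd (by omega) h

theorem signEquiv_one_iff {n i j : ℕ} : SignEquiv 1 n i j ↔ signSum i n = signSum j n := by
  rw [SignEquiv, pow_one, X_dvd_iff, coeff_sub, sub_eq_zero, signSum, signSum]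

theorem signEquiv_succ_iff {k n i j : ℕ} (h : thueMorse i = thueMorse j) :
    SignEquiv k (n + 1) i j ↔ SignEquiv k n (i + 1) (j + 1) := by
  rw [SignEquiv, fac, fac, factorAt_succ, factorAt_succ, h, pow_dvd_signPoly_cons_iff, SignEquiv]

theorem signEquiv_succ_iff' {k n i j : ℕ} (h : thueMorse (i + n) = thueMorse (j + n)) :
    SignEquiv k (n + 1) i j ↔ SignEquiv k n i j := by
  rw [SignEquiv, fac, fac, factorAt_succ', factorAt_succ', h, SignEquiv,
    pow_dvd_signPoly_concat_iff _ (by simp [length_factorAt])]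

theorem signEquiv_even_even {k m i j : ℕ} :
    SignEquiv (k + 1) (2 * m) (2 * i) (2 * j) ↔ SignEquiv k m i j := by
  rw [SignEquiv, ← phi_fac, ← phi_fac, pow_succ_dvd_signPoly_phi_iff, SignEquiv]

theorem signEquiv_even_odd {k m i j : ℕ} :
    SignEquiv (k + 1) (2 * m + 1) (2 * i) (2 * j) ↔
      SignEquiv k (m + 1) i j ∧ thueMorse (i + m) = thueMorse (j + m) := by
  have key : thueMorse (i + m) = thueMorse (j + m) →
      (SignEquiv (k + 1) (2 * m + 1) (2 * i) (2 * j) ↔ SignEquiv k (m + 1) i j) := fun h => by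
    rw [SignEquiv, SignEquiv, ← pow_succ_dvd_signPoly_phi_iff (k := k) (u := fac i (m + 1)),
      phi_fac_eq_concat,
      phi_fac_eq_concat, h, pow_dvd_signPoly_concat_iff _ (by simp [length_factorAt])]
  refine ⟨fun h => ?_, fun h => (key h.2).2 h.1⟩
  have h₀ := h.signSum_eq k.succ_pos
  rw [signSum_even_odd, signSum_even_odd] at h₀
  have h₁ := sign_injective h₀
  exact ⟨(key h₁).1 h, h₁⟩

theorem signEquiv_odd_odd {k m i j : ℕ} :
    SignEquiv (k + 1) (2 * m + 1) (2 * i + 1) (2 * j + 1) ↔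
      SignEquiv k (m + 1) i j ∧ thueMorse i = thueMorse j := by
  have key : thueMorse i = thueMorse j →
      (SignEquiv (k + 1) (2 * m + 1) (2 * i + 1) (2 * j + 1) ↔ SignEquiv k (m + 1) i j) :=
    fun h => by
    rw [SignEquiv, SignEquiv, ← pow_succ_dvd_signPoly_phi_iff (k := k) (u := fac i (m + 1)),
      phi_fac_eq_cons,
      phi_fac_eq_cons, h, pow_dvd_signPoly_cons_iff]
  refine ⟨fun h => ?_, fun h => (key h.2).2 h.1⟩
  have h₀ := h.signSum_eq k.succ_pos
  rw [signSum_odd_odd, signSum_odd_odd, neg_inj] at h₀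
  have h₁ := sign_injective h₀
  exact ⟨(key h₁).1 h, h₁⟩

theorem signEquiv_odd_even {k m i j : ℕ} (hk : 0 < k) (hm : 0 < m) :
    SignEquiv (k + 1) (2 * m) (2 * i + 1) (2 * j + 1) ↔
      SignEquiv k (m + 1) i j ∧ thueMorse i = thueMorse j ∧
        thueMorse (i + m) = thueMorse (j + m) := by
  have key : thueMorse i = thueMorse j → thueMorse (i + m) = thueMorse (j + m) →
      (SignEquiv (k + 1) (2 * m) (2 * i + 1) (2 * j + 1) ↔ SignEquiv k (m + 1) i j) :=
    fun h h' => by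
    rw [SignEquiv, SignEquiv, ← pow_succ_dvd_signPoly_phi_iff (k := k) (u := fac i (m + 1)),
      phi_fac_eq_cons_concat,
      phi_fac_eq_cons_concat, h, h', pow_dvd_signPoly_cons_iff,
      pow_dvd_signPoly_concat_iff _ (by simp [length_factorAt])]
  refine ⟨fun h => ?_, fun h => (key h.2.1 h.2.2).2 h.1⟩
  have h₀ := h.signSum_eq k.succ_pos
  have h₁ := h.coeff_one_eq hk
  rw [signSum_odd_even, signSum_odd_even] at h₀
  rw [coeff_one_odd_even, coeff_one_odd_even] at h₁
  have b := signSum_le_two i (m + 1)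
  have b' := signSum_le_two j (m + 1)
  -- If these signs differ, equality of the sums leaves only the case where each factor has equal
  -- signs at `i`, `i + m` (resp. `j`, `j + m`), opposite between the two factors. Coefficient `1`
  -- then makes `4m + 2 ≥ 6` a difference of two sign sums, which is at most `4`.
  have hs : sign (thueMorse i) = sign (thueMorse j) := by
    rcases sign_eq_or (thueMorse i) with e₁ | e₁ <;>
    rcases sign_eq_or (thueMorse j) with e₂ | e₂ <;>
    rcases sign_eq_or (thueMorse (i + m)) with e₃ | e₃ <;>
    rcases sign_eq_or (thueMorse (j + m)) with e₄ | e₄ <;>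
    rw [e₁, e₂, e₃, e₄] at h₀ h₁ <;> omega
  have t₁ := sign_injective hs
  have t₂ := sign_injective (show sign (thueMorse (i + m)) = sign (thueMorse (j + m)) by linarith)
  exact ⟨(key t₁ t₂).1 h, t₁, t₂⟩

/-- Equal sums force equal letters at `j` and `j + m`; then `2m + 1 ≥ 5` would be, up to sign, a
difference of two sign sums, which is at most `4`. -/
theorem not_signEquiv_even {k m i j : ℕ} (hk : 0 < k) (hm : 2 ≤ m) :
    ¬ SignEquiv (k + 1) (2 * m) (2 * i) (2 * j + 1) := by
  intro h
  have h₀ := h.signSum_eq k.succ_pos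
  have h₁ := h.coeff_one_eq hk
  rw [signSum_even_even, signSum_odd_even] at h₀
  rw [coeff_one_even_even, coeff_one_odd_even] at h₁
  have b := signSum_le_two i m
  have b' := signSum_le_two j (m + 1)
  rcases sign_eq_or (thueMorse j) with e₂ | e₂ <;>
  rcases sign_eq_or (thueMorse (j + m)) with e₄ | e₄ <;>
  rw [e₂, e₄] at h₀ h₁ <;> omega

/-- As in the even case, with `2m + 2 ≥ 6` in place of `2m + 1`. -/
theorem not_signEquiv_odd {k m i j : ℕ} (hk : 0 < k) (hm : 2 ≤ m) :
    ¬ SignEquiv (k + 1) (2 * m + 1) (2 * i) (2 * j + 1) := by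
  intro h
  have h₀ := h.signSum_eq k.succ_pos
  have h₁ := h.coeff_one_eq hk
  rw [signSum_even_odd, signSum_odd_odd] at h₀
  rw [coeff_one_even_odd, coeff_one_odd_odd] at h₁
  have b := signSum_le_two i (m + 1)
  have b' := signSum_le_two j (m + 1)
  rcases sign_eq_or (thueMorse j) with e₂ | e₂ <;>
  rcases sign_eq_or (thueMorse (i + m)) with e₄ | e₄ <;>
  rw [e₂, e₄] at h₀ h₁ <;> omega

theorem SignEquiv.fac_eq_of_le_three {k n i j : ℕ} (hk : 2 ≤ k) (hn : n ≤ 3)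
    (h : SignEquiv k n i j) : fac i n = fac j n :=
  eq_of_coeff_signPoly_eq (by simp [length_factorAt]) (by simpa [length_factorAt] using hn)
    (coeff_eq_of_pow_dvd (by omega) h) (coeff_eq_of_pow_dvd (by omega) h)

theorem signEquiv_iff_binomEquiv {k : ℕ} (hk : 0 < k) (n i j : ℕ) :
    SignEquiv k n i j ↔ BinomEquiv k (fac i n) (fac j n) := by
  refine ⟨?_, BinomEquiv.pow_dvd⟩
  induction k, hk using Nat.le_induction generalizing n i j with
  | base =>
    exact fun h => binomEquiv_one_of_coeff_zero (by simp [length_factorAt])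
      (signEquiv_one_iff.1 h)
  | succ k hk ih =>
    intro h
    have hphi : ∀ {m i j}, SignEquiv k m i j →
        BinomEquiv (k + 1) (phi (fac i m)) (phi (fac j m)) := fun h =>
      (ih _ _ _ h).phi (by simp [length_factorAt])
    -- Parity need not be detectable on such short factors, but the first two coefficients already
    -- determine the word.
    rcases le_or_gt n 3 with hn | hn
    · rw [h.fac_eq_of_le_three (by omega) hn]
      exact fun _ _ => rfl
    obtain ⟨i, rfl | rfl⟩ := i.even_or_odd' <;> obtain ⟨j, rfl | rfl⟩ := j.even_or_odd' <;>
      obtain ⟨m, rfl | rfl⟩ := n.even_or_odd'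
    · simpa only [phi_fac] using hphi (signEquiv_even_even.1 h)
    · obtain ⟨h₁, h₂⟩ := signEquiv_even_odd.1 h
      simpa only [phi_fac_eq_concat, h₂, binomEquiv_concat_iff] using hphi h₁
    · exact absurd h (not_signEquiv_even hk (by omega))
    · exact absurd h (not_signEquiv_odd hk (by omega))
    · exact absurd h.symm (not_signEquiv_even hk (by omega))
    · exact absurd h.symm (not_signEquiv_odd hk (by omega))
    · obtain ⟨h₁, h₂, h₃⟩ := (signEquiv_odd_even hk (by omega)).1 h
      simpa only [phi_fac_eq_cons_concat, h₂, h₃, binomEquiv_cons_iff, binomEquiv_concat_iff]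
        using hphi h₁
    · obtain ⟨h₁, h₂⟩ := signEquiv_odd_odd.1 h
      simpa only [phi_fac_eq_cons, h₂, binomEquiv_cons_iff] using hphi h₁

/-- On factors of length less than `2 ^ k`, sign equivalence is equality. -/
theorem SignEquiv.fac_eq {k : ℕ} (hk : 0 < k) {n i j : ℕ} (hn : n < 2 ^ k)
    (h : SignEquiv k n i j) : fac i n = fac j n := by
  induction k, hk using Nat.le_induction generalizing n i j with
  | base =>
    obtain rfl | rfl : n = 0 ∨ n = 1 := by omega
    · rfl
    · have h' := signEquiv_one_iff.1 h
      simp only [signSum, fac, factorAt_succ, coeff_zero_signPoly_cons] at h' ⊢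
      rw [sign_injective (add_right_cancel h')]
      rfl
  | succ k hk ih =>
    rcases le_or_gt n 3 with hn3 | hn3
    · exact h.fac_eq_of_le_three (by omega) hn3
    rw [pow_succ] at hn
    -- Completing the cut blocks gives a preimage of length `m + 1`, possibly equal to `2 ^ k`;
    -- removing a known common end letter brings it back into the range of the induction.
    have hhead : ∀ {m i j}, m < 2 ^ k → SignEquiv k (m + 1) i j → thueMorse i = thueMorse j →
        fac i (m + 1) = fac j (m + 1) := fun hm h e => by
      rw [fac, fac, factorAt_succ, factorAt_succ, e]
      exact congrArg _ (ih hm ((signEquiv_succ_iff e).1 h))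
    obtain ⟨i, rfl | rfl⟩ := i.even_or_odd' <;> obtain ⟨j, rfl | rfl⟩ := j.even_or_odd' <;>
      obtain ⟨m, rfl | rfl⟩ := n.even_or_odd'
    · rw [← phi_fac, ← phi_fac, ih (by omega) (signEquiv_even_even.1 h)]
    · obtain ⟨h₁, h₂⟩ := signEquiv_even_odd.1 h
      have h₃ := ih (by omega) ((signEquiv_succ_iff' h₂).1 h₁)
      have e : fac i (m + 1) = fac j (m + 1) := by
        rw [fac, fac, factorAt_succ', factorAt_succ', h₂]
        exact congrArg (· ++ [thueMorse (j + m)]) h₃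
      have e' := congrArg phi e
      rw [phi_fac_eq_concat, phi_fac_eq_concat, h₂] at e'
      exact List.append_cancel_right e'
    · exact absurd h (not_signEquiv_even hk (by omega))
    · exact absurd h (not_signEquiv_odd hk (by omega))
    · exact absurd h.symm (not_signEquiv_even hk (by omega))
    · exact absurd h.symm (not_signEquiv_odd hk (by omega))
    · obtain ⟨h₁, h₂, h₃⟩ := (signEquiv_odd_even hk (by omega)).1 h
      have e := phi_fac_eq_cons_concat i m
      rw [hhead (by omega) h₁ h₂, phi_fac_eq_cons_concat, h₂, h₃] at e
      exact (List.append_cancel_right (List.tail_eq_of_cons_eq e)).symm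
    · obtain ⟨h₁, h₂⟩ := signEquiv_odd_odd.1 h
      have e := phi_fac_eq_cons i m
      rw [hhead (by omega) h₁ h₂, phi_fac_eq_cons, h₂] at e
      exact (List.tail_eq_of_cons_eq e).symm

/-! ### Counting classes -/

theorem encard_range_congr {γ δ : Type*} {c : ℕ → γ} {d : ℕ → δ}
    (h : ∀ i j, c i = c j ↔ d i = d j) : (Set.range c).encard = (Set.range d).encard := by
  have hk : Setoid.ker c = Setoid.ker d := Setoid.ext h
  have e₁ := Setoid.quotientKerEquivRange c
  have e₂ := Setoid.quotientKerEquivRange d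
  rw [← hk] at e₂
  exact ENat.card_congr (e₁.symm.trans e₂)

theorem range_eq_union_even_odd {γ : Type*} (c : ℕ → γ) :
    Set.range c = Set.range (fun i => c (2 * i)) ∪ Set.range (fun i => c (2 * i + 1)) := by
  ext x
  constructor
  · rintro ⟨i, rfl⟩
    obtain ⟨i, rfl | rfl⟩ := i.even_or_odd'
    · exact Or.inl ⟨i, rfl⟩
    · exact Or.inr ⟨i, rfl⟩
  · rintro (⟨i, rfl⟩ | ⟨i, rfl⟩) <;> exact ⟨_, rfl⟩

theorem encard_range_even_odd {γ : Type*} {c : ℕ → γ} (h : ∀ i j, c (2 * i) ≠ c (2 * j + 1)) :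
    (Set.range c).encard =
      (Set.range fun i => c (2 * i)).encard + (Set.range fun i => c (2 * i + 1)).encard := by
  rw [range_eq_union_even_odd, Set.encard_union_eq]
  rw [Set.disjoint_left]
  rintro _ ⟨i, rfl⟩ ⟨j, hj⟩
  exact h i j hj.symm

/-- Sign equivalence of factors of length `n`, refined by the first letter if `f` holds and by the
last letter if `l` holds. -/
def refinedSetoid (k : ℕ) (f l : Prop) (n : ℕ) : Setoid ℕ where
  r i j := SignEquiv k n i j ∧ (f → thueMorse i = thueMorse j) ∧
    (l → thueMorse (i + (n - 1)) = thueMorse (j + (n - 1)))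
  iseqv :=
    { refl := fun _ => ⟨by simp [SignEquiv], fun _ => rfl, fun _ => rfl⟩
      symm := fun h => ⟨h.1.symm, fun hf => (h.2.1 hf).symm, fun hl => (h.2.2 hl).symm⟩
      trans := fun h h' => ⟨by simpa [SignEquiv] using dvd_add h.1 h'.1,
        fun hf => (h.2.1 hf).trans (h'.2.1 hf), fun hl => (h.2.2 hl).trans (h'.2.2 hl)⟩ }

/-- The class of a position under `refinedSetoid`. -/
def refinedClass (k : ℕ) (f l : Prop) (n : ℕ) (i : ℕ) : Quotient (refinedSetoid k f l n) :=
  Quotient.mk _ i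

theorem refinedClass_eq_iff {k : ℕ} {f l : Prop} {n i j : ℕ} :
    refinedClass k f l n i = refinedClass k f l n j ↔
      SignEquiv k n i j ∧ (f → thueMorse i = thueMorse j) ∧
        (l → thueMorse (i + (n - 1)) = thueMorse (j + (n - 1))) :=
  Quotient.eq

/-- The number of classes of factors of length `n` under `refinedSetoid`. -/
noncomputable def numClasses (k : ℕ) (f l : Prop) (n : ℕ) : ℕ∞ :=
  (Set.range (refinedClass k f l n)).encard

theorem one_sub_inj {a b : Letter} : 1 - a = 1 - b ↔ a = b := by
  revert a b
  decide

/-- At even positions no block is cut and both flags pass to the preimage. At odd positions both end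
blocks are cut, and the equivalence already fixes both end letters, so the flags add nothing. -/
theorem numClasses_even {k m : ℕ} (f l : Prop) (hk : 0 < k) (hm : 2 ≤ m) :
    numClasses (k + 1) f l (2 * m) = numClasses k f l m + numClasses k True True (m + 1) := by
  rw [numClasses, encard_range_even_odd]
  · congr 1
    · refine encard_range_congr fun i j => ?_
      have e : ∀ i, 2 * i + (2 * m - 1) = 2 * (i + (m - 1)) + 1 := fun i => by omega
      simp only [refinedClass_eq_iff, signEquiv_even_even, thueMorse_two_mul, e,
        thueMorse_two_mul_add_one, one_sub_inj]
    · refine encard_range_congr fun i j => ?_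
      have e : ∀ i, 2 * i + 1 + (2 * m - 1) = 2 * (i + m) := fun i => by omega
      simp only [refinedClass_eq_iff, signEquiv_odd_even hk (by omega : 0 < m), thueMorse_two_mul,
        e, thueMorse_two_mul_add_one, one_sub_inj, Nat.add_sub_cancel]
      tauto
  · intro i j h
    exact not_signEquiv_even hk hm (refinedClass_eq_iff.1 h).1

/-- Exactly one end block is cut; the equivalence fixes the letter there, and the flag of the other
end passes to the preimage. -/
theorem numClasses_odd {k m : ℕ} (f l : Prop) (hk : 0 < k) (hm : 2 ≤ m) :
    numClasses (k + 1) f l (2 * m + 1) =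
      numClasses k f True (m + 1) + numClasses k True l (m + 1) := by
  rw [numClasses, encard_range_even_odd]
  · congr 1
    · refine encard_range_congr fun i j => ?_
      have e : ∀ i, 2 * i + 2 * m = 2 * (i + m) := fun i => by omega
      simp only [refinedClass_eq_iff, signEquiv_even_odd, thueMorse_two_mul, e,
        Nat.add_sub_cancel]
      tauto
    · refine encard_range_congr fun i j => ?_
      have e : ∀ i, 2 * i + 1 + 2 * m = 2 * (i + m) + 1 := fun i => by omega
      simp only [refinedClass_eq_iff, signEquiv_odd_odd,
        e, thueMorse_two_mul_add_one, one_sub_inj, Nat.add_sub_cancel]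
      tauto
  · intro i j h
    exact not_signEquiv_odd hk hm (refinedClass_eq_iff.1 h).1

/-! ### First letters, last letters and sums of signs -/

/-- Descent on the distance: an even one is halved, and `2e + 1` is the distance from `2i + 1` to
`2(i + e + 1)`, which reduces to `e + 1` with the first letter complemented. -/
theorem exists_thueMorse_pair {d : ℕ} (hd : 0 < d) (a b : Letter) :
    ∃ i, thueMorse i = a ∧ thueMorse (i + d) = b := by
  induction d using Nat.strong_induction_on generalizing a b with
  | _ d ih =>
    obtain ⟨e, rfl | rfl⟩ := d.even_or_odd'
    · obtain ⟨i, h₁, h₂⟩ := ih e (by omega) (by omega) a b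
      refine ⟨2 * i, by rwa [thueMorse_two_mul], ?_⟩
      rwa [← mul_add, thueMorse_two_mul]
    · rcases e.eq_zero_or_pos with rfl | he
      · have key : ∀ a b : Letter, ∃ i < 6, thueMorse i = a ∧ thueMorse (i + 1) = b := by decide
        obtain ⟨i, -, hi⟩ := key a b
        exact ⟨i, hi⟩
      · obtain ⟨i, h₁, h₂⟩ := ih (e + 1) (by omega) (by omega) (1 - a) b
        refine ⟨2 * i + 1, ?_, ?_⟩
        · rw [thueMorse_two_mul_add_one, h₁]
          exact sub_sub_cancel 1 a
        · rwa [show 2 * i + 1 + (2 * e + 1) = 2 * (i + (e + 1)) by ring, thueMorse_two_mul]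

theorem range_thueMorse_pair {γ : Type*} [DecidableEq γ] {d : ℕ} (hd : 0 < d)
    (F : Letter × Letter → γ) :
    Set.range (fun i => F (thueMorse i, thueMorse (i + d))) = ↑(Finset.univ.image F) := by
  ext x
  simp only [Set.mem_range, Finset.coe_image, Finset.coe_univ, Set.image_univ]
  constructor
  · rintro ⟨i, rfl⟩
    exact ⟨_, rfl⟩
  · rintro ⟨⟨a, b⟩, rfl⟩
    obtain ⟨i, h₁, h₂⟩ := exists_thueMorse_pair hd a b
    exact ⟨i, by rw [h₁, h₂]⟩

theorem range_thueMorse {γ : Type*} [DecidableEq γ] (F : Letter → γ) :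
    Set.range (fun i => F (thueMorse i)) = ↑(Finset.univ.image F) := by
  rw [← (show Finset.univ.image (fun p : Letter × Letter => F p.1) = Finset.univ.image F by
    ext; simp), ← range_thueMorse_pair one_pos]

/-- The first letter, the last letter and the sum of signs of a factor. -/
noncomputable def profile (n i : ℕ) : Letter × Letter × ℤ :=
  (thueMorse i, thueMorse (i + (n - 1)), signSum i n)

/-- The profiles of factors of even length at odd positions. -/
def oddEvenProfiles : Finset (Letter × Letter × ℤ) :=
  Finset.univ.image fun p : Letter × Letter => (1 - p.1, p.2, sign p.2 - sign p.1)

/-- The profiles of factors of odd length. -/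
def oddProfiles : Finset (Letter × Letter × ℤ) :=
  (Finset.univ.image fun p : Letter × Letter => (p.1, p.2, sign p.2)) ∪
    Finset.univ.image fun p : Letter × Letter => (1 - p.1, 1 - p.2, -sign p.1)

/-- The profiles of factors of even length at least `4`. -/
def evenProfiles : Finset (Letter × Letter × ℤ) :=
  (Finset.univ.image fun p : Letter × Letter => (p.1, 1 - p.2, 0)) ∪ oddEvenProfiles

/-- The profiles of factors of length `2`. -/
def twoProfiles : Finset (Letter × Letter × ℤ) :=
  (Finset.univ.image fun a : Letter => (a, 1 - a, 0)) ∪ oddEvenProfiles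

theorem profile_even_even {m : ℕ} (hm : 0 < m) (i : ℕ) :
    profile (2 * m) (2 * i) = (thueMorse i, 1 - thueMorse (i + (m - 1)), 0) := by
  rw [profile, thueMorse_two_mul, signSum_even_even,
    show 2 * i + (2 * m - 1) = 2 * (i + (m - 1)) + 1 by omega, thueMorse_two_mul_add_one]

theorem range_profile_odd_even {m : ℕ} (hm : 0 < m) :
    Set.range (fun i => profile (2 * m) (2 * i + 1)) = ↑oddEvenProfiles := by
  rw [oddEvenProfiles, ← range_thueMorse_pair hm]
  congr 1
  funext i
  rw [profile, signSum_odd_even, show 2 * i + 1 + (2 * m - 1) = 2 * (i + m) by omega,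
    thueMorse_two_mul, thueMorse_two_mul_add_one]

/-- Length `2` is separate because an even position gives a single block, whose two letters are not
independent. -/
theorem range_profile_two : Set.range (profile 2) = ↑twoProfiles := by
  rw [range_eq_union_even_odd, twoProfiles, Finset.coe_union,
    ← range_profile_odd_even one_pos, ← range_thueMorse]
  congr 2
  funext i
  exact profile_even_even one_pos i

theorem range_profile_even {m : ℕ} (hm : 2 ≤ m) :
    Set.range (profile (2 * m)) = ↑evenProfiles := by
  rw [range_eq_union_even_odd, evenProfiles, Finset.coe_union,
    ← range_profile_odd_even (by omega : 0 < m),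
    ← range_thueMorse_pair (by omega : 0 < m - 1)]
  congr 2
  funext i
  exact profile_even_even (by omega) i

theorem range_profile_odd {m : ℕ} (hm : 0 < m) :
    Set.range (profile (2 * m + 1)) = ↑oddProfiles := by
  rw [range_eq_union_even_odd, oddProfiles, Finset.coe_union, ← range_thueMorse_pair hm,
    ← range_thueMorse_pair hm]
  congr 2 <;> funext i
  · rw [profile, signSum_even_odd, show 2 * i + (2 * m + 1 - 1) = 2 * (i + m) by omega,
      thueMorse_two_mul, thueMorse_two_mul]
  · rw [profile, signSum_odd_odd, show 2 * i + 1 + (2 * m + 1 - 1) = 2 * (i + m) + 1 by omega,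
      thueMorse_two_mul_add_one, thueMorse_two_mul_add_one]

theorem numClasses_one_eq_card {γ : Type*} [DecidableEq γ] {f l : Prop} {n : ℕ}
    {T : Finset (Letter × Letter × ℤ)} (hT : Set.range (profile n) = ↑T)
    (π : Letter × Letter × ℤ → γ)
    (hπ : ∀ x y, π x = π y ↔ x.2.2 = y.2.2 ∧ (f → x.1 = y.1) ∧ (l → x.2.1 = y.2.1)) :
    numClasses 1 f l n = (T.image π).card := by
  rw [numClasses, encard_range_congr (d := π ∘ profile n), Set.range_comp, hT, ← Finset.coe_image,
    Set.encard_coe_eq_coe_finsetCard]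
  intro i j
  rw [refinedClass_eq_iff, Function.comp, Function.comp, hπ, signEquiv_one_iff]
  rfl

/-- The last count needs `3 ≤ n`: at length `2` the end letters determine the word and give only `4`
classes. -/
theorem numClasses_one {n : ℕ} (hn : 2 ≤ n) :
    numClasses 1 False False n = (if n ≡ 0 [MOD 2] then 3 else 2 : ℕ) ∧
    numClasses 1 True False n = 4 ∧ numClasses 1 False True n = 4 ∧
    (3 ≤ n → numClasses 1 True True n = 6) := by
  have h₀ : ∀ x y : Letter × Letter × ℤ, x.2.2 = y.2.2 ↔
      x.2.2 = y.2.2 ∧ (False → x.1 = y.1) ∧ (False → x.2.1 = y.2.1) := by tauto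
  have h₁ : ∀ x y : Letter × Letter × ℤ, (x.1, x.2.2) = (y.1, y.2.2) ↔
      x.2.2 = y.2.2 ∧ (True → x.1 = y.1) ∧ (False → x.2.1 = y.2.1) := by
    simp only [Prod.mk.injEq]; tauto
  have h₂ : ∀ x y : Letter × Letter × ℤ, x.2 = y.2 ↔
      x.2.2 = y.2.2 ∧ (False → x.1 = y.1) ∧ (True → x.2.1 = y.2.1) := by
    simp only [Prod.ext_iff]; tauto
  have h₃ : ∀ x y : Letter × Letter × ℤ, x = y ↔
      x.2.2 = y.2.2 ∧ (True → x.1 = y.1) ∧ (True → x.2.1 = y.2.1) := by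
    simp only [Prod.ext_iff]; tauto
  obtain ⟨m, rfl | rfl⟩ := n.even_or_odd'
  · rw [if_pos (by simp [Nat.ModEq])]
    obtain rfl | hm : m = 1 ∨ 2 ≤ m := by omega
    · have hT := range_profile_two
      refine ⟨?_, ?_, ?_, fun h => by omega⟩
      · exact (numClasses_one_eq_card hT (fun x => x.2.2) h₀).trans (congrArg _ (by decide))
      · exact (numClasses_one_eq_card hT (fun x => (x.1, x.2.2)) h₁).trans
          (congrArg _ (by decide : _ = 4))
      · exact (numClasses_one_eq_card hT (fun x => x.2) h₂).trans (congrArg _ (by decide : _ = 4))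
    · have hT := range_profile_even hm
      refine ⟨?_, ?_, ?_, fun _ => ?_⟩
      · exact (numClasses_one_eq_card hT (fun x => x.2.2) h₀).trans (congrArg _ (by decide))
      · exact (numClasses_one_eq_card hT (fun x => (x.1, x.2.2)) h₁).trans
          (congrArg _ (by decide : _ = 4))
      · exact (numClasses_one_eq_card hT (fun x => x.2) h₂).trans (congrArg _ (by decide : _ = 4))
      · exact (numClasses_one_eq_card hT (fun x => x) h₃).trans (congrArg _ (by decide : _ = 6))
  · rw [if_neg (by simp [Nat.ModEq])]
    have hT := range_profile_odd (by omega : 0 < m)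
    refine ⟨?_, ?_, ?_, fun _ => ?_⟩
    · exact (numClasses_one_eq_card hT (fun x => x.2.2) h₀).trans (congrArg _ (by decide))
    · exact (numClasses_one_eq_card hT (fun x => (x.1, x.2.2)) h₁).trans
        (congrArg _ (by decide : _ = 4))
    · exact (numClasses_one_eq_card hT (fun x => x.2) h₂).trans (congrArg _ (by decide : _ = 4))
    · exact (numClasses_one_eq_card hT (fun x => x) h₃).trans (congrArg _ (by decide : _ = 6))

/-- The four counts are proved together since the recurrences mix them. Only the unrefined count
depends on divisibility: an even length adds `3 * 2 ^ k` to the count at half the length, while an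
odd length gives `2 * (3 * 2 ^ k - 2)`. -/
theorem numClasses_eq {k : ℕ} (hk : 0 < k) {n : ℕ} (hn : 2 ^ k ≤ n) :
    numClasses k False False n =
      (if n ≡ 0 [MOD 2 ^ k] then 3 * 2 ^ k - 3 else 3 * 2 ^ k - 4 : ℕ) ∧
    numClasses k True False n = (3 * 2 ^ k - 2 : ℕ) ∧
    numClasses k False True n = (3 * 2 ^ k - 2 : ℕ) ∧
    (2 ^ k < n → numClasses k True True n = (3 * 2 ^ k : ℕ)) := by
  induction k, hk using Nat.le_induction generalizing n with
  | base => exact numClasses_one hn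
  | succ k hk ih =>
    have h2 : 2 ≤ 2 ^ k := Nat.le_self_pow (by omega) 2
    rw [pow_succ] at hn ⊢
    obtain ⟨m, rfl | rfl⟩ := n.even_or_odd'
    · obtain ⟨i₁, i₂, i₃, i₄⟩ := ih (n := m) (by omega)
      have j := (ih (n := m + 1) (by omega)).2.2.2 (by omega)
      simp only [numClasses_even _ _ hk (by omega : 2 ≤ m), i₁, i₂, i₃, j, ← Nat.cast_add,
        Nat.cast_inj]
      have e : 2 * m ≡ 0 [MOD 2 ^ k * 2] ↔ m ≡ 0 [MOD 2 ^ k] := by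
        rw [Nat.modEq_zero_iff_dvd, Nat.modEq_zero_iff_dvd, mul_comm (2 ^ k),
          Nat.mul_dvd_mul_iff_left two_pos]
      refine ⟨?_, by omega, by omega, fun h => ?_⟩
      · simp only [e]
        split_ifs <;> omega
      · rw [i₄ (by omega), ← Nat.cast_add, Nat.cast_inj]
        omega
    · obtain ⟨i₁, i₂, i₃, i₄⟩ := ih (n := m + 1) (by omega)
      have j := i₄ (by omega)
      simp only [numClasses_odd _ _ hk (by omega : 2 ≤ m), i₂, i₃, j, ← Nat.cast_add,
        Nat.cast_inj]
      have e : ¬ 2 * m + 1 ≡ 0 [MOD 2 ^ k * 2] := by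
        rw [Nat.modEq_zero_iff_dvd]
        intro h
        have := (Dvd.intro_left _ rfl : 2 ∣ 2 ^ k * 2).trans h
        omega
      rw [if_neg e]
      omega

/-! ### Complexities -/

theorem binomComplexity_eq_numClasses {k : ℕ} (hk : 0 < k) (n : ℕ) :
    binomComplexity thueMorse k n = (numClasses k False False n).toNat := by
  let s := (binomSetoid k).comap (Subtype.val : Fac thueMorse n → Word)
  let c : ℕ → Quotient s := fun i => Quotient.mk s ⟨fac i n, i, rfl⟩
  have hc : Set.range c = Set.univ := by
    refine Set.range_eq_univ.2 fun q => ?_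
    induction q using Quotient.inductionOn with
    | _ w =>
      obtain ⟨_, i, rfl⟩ := w
      exact ⟨i, rfl⟩
  rw [numClasses, encard_range_congr (d := c), hc, Set.encard_univ]
  · rfl
  · intro i j
    rw [refinedClass_eq_iff, signEquiv_iff_binomEquiv hk]
    simp only [false_imp_iff, and_true]
    exact ⟨fun h => Quotient.sound (s := s) h, fun h => Quotient.exact (s := s) h⟩

theorem binomComplexity_eq_factorComplexity {k n : ℕ} (hk : 0 < k) (hn : n < 2 ^ k) :
    binomComplexity thueMorse k n = factorComplexity thueMorse n := by
  refine (Nat.card_congr (Equiv.ofBijective (Quotient.mk _) ⟨?_, Quotient.mk_surjective⟩)).symm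
  rintro ⟨_, i, rfl⟩ ⟨_, j, rfl⟩ h
  exact Subtype.ext (SignEquiv.fac_eq hk hn
    ((signEquiv_iff_binomEquiv hk n i j).2 (Quotient.exact h)))

end ThueMorse

theorem theorem1 (k : ℕ) (hk : 0 < k) :
    (∀ n : ℕ, n ≤ 2 ^ k - 1 →
      ThueMorse.binomComplexity ThueMorse.thueMorse k n =
        ThueMorse.factorComplexity ThueMorse.thueMorse n) ∧
    (∀ n : ℕ, 2 ^ k ≤ n →
      ThueMorse.binomComplexity ThueMorse.thueMorse k n =
        if n ≡ 0 [MOD 2 ^ k] then 3 * 2 ^ k - 3 else 3 * 2 ^ k - 4) := by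
  refine ⟨fun n hn => ?_, fun n hn => ?_⟩
  · have : 0 < 2 ^ k := Nat.two_pow_pos k
    exact ThueMorse.binomComplexity_eq_factorComplexity hk (by omega)
  · rw [ThueMorse.binomComplexity_eq_numClasses hk, (ThueMorse.numClasses_eq hk hn).1,
      ENat.toNat_natCast]
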